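/- For an entire function $f:\mathbb{C}\to\mathbb{C}$, let its order $\alpha(f)\in[0,+\infty]$ be the infimum of all real numbers $\alpha\ge 0$ such that $\log\max_{|z|\le r}|f(z)|\le O(r^\alpha)$ as $r\to\infty$ (with $\alpha(f)=+\infty$ if there is no such $\alpha$). Let $w=\sqrt{z^2-1}$, and define the degree of the zero polynomial to be $-1$. Theorem. Let $x,y$ be entire functions with $x^2-(z^2-1)y^2=1$, given by $$x+yw=\epsilon\cdot(z+w)^n\exp(hw)$$ for some $\epsilon\in\{-1,1\}$, some $n\in\mathbb{Z}$ and some entire function $h$. Let $\rho\ge 0$ be a real number. If $\alpha(y)\le\rho$, then $h$ is a polynomial of degree at most $\lfloor\rho\rfloor-1$. -/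

import Mathlib

/-- The maximum modulus `max_{|z| ≤ r} |f z|`. -/
noncomputable def maxModulus (f : ℂ → ℂ) (r : ℝ) : ℝ :=
  sSup ((fun z : ℂ => ‖f z‖) '' Metric.closedBall 0 r)

/-- `log max_{|z| ≤ r} |f z| ≤ O(r ^ α)` as `r → ∞`. -/
def HasGrowthBound (f : ℂ → ℂ) (α : ℝ) : Prop :=
  ∃ C : ℝ, ∀ᶠ r : ℝ in Filter.atTop, Real.log (maxModulus f r) ≤ C * r ^ α

/-- The order of an entire function: the infimum of all real `α ≥ 0` admitted by the growth bound,
taken in the extended reals, so that it is `⊤` if there is no such `α`. -/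
noncomputable def entireOrder (f : ℂ → ℂ) : EReal :=
  sInf {a : EReal | ∃ α : ℝ, 0 ≤ α ∧ HasGrowthBound f α ∧ a = (α : EReal)}

/-- `(x, y)` is a solution, in the ring of entire functions, of `X² - (z² - 1) Y² = 1`. -/
structure IsEntirePellSolution (x y : ℂ → ℂ) : Prop where
  entire_x : Differentiable ℂ x
  entire_y : Differentiable ℂ y
  pell : ∀ z : ℂ, x z ^ 2 - (z ^ 2 - 1) * y z ^ 2 = 1

/-- The degree of a complex polynomial, where the zero polynomial has degree `-1`. -/
noncomputable def intDegree (p : Polynomial ℂ) : ℤ :=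
  open Classical in if p = 0 then -1 else (p.natDegree : ℤ)

/-!
The numbers `x + y * w` and `x - y * w` are inverse to each other and differ by `2 * y * w`, so
`|log ‖x + y * w‖|` is at most `log⁺ ‖2 * y * w‖` up to a constant. In the same way `|log ‖z + w‖|`
is at most `log⁺ ‖2 * w‖` up to a constant, because `(z + w) * (z - w) = 1`. Taking logarithms of
absolute values in the parametrization therefore bounds `re (h * w)` by `O(‖z‖ ^ b)` whenever `y`
has order less than `b`. The function `h * w` is two-valued, but its square `(z ^ 2 - 1) * h ^ 2` is
entire, and Borel–Carathéodory applied to this square gives `h * w = O(‖z‖ ^ b)`. Hence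
`h = O(‖z‖ ^ (b - 1))`, and Cauchy's estimates make `h` a polynomial of degree at most `b - 1`.
-/

open Asymptotics Bornology Filter Metric Real

lemma intDegree_lt_natCast_iff {p : Polynomial ℂ} {N : ℕ} : intDegree p < N ↔ p.degree < N := by
  unfold intDegree
  split_ifs with hp
  · have hN : (-1 : ℤ) < N := by omega
    simp only [hN, hp, Polynomial.degree_zero, WithBot.bot_lt_natCast]
  · rw [Polynomial.degree_eq_natDegree hp]
    norm_cast

section EntireFunctions

variable {f : ℂ → ℂ} {β γ M : ℝ}

lemma iteratedDeriv_zero_eq_zero_of_isBigO_rpow {F : Type*} [NormedAddCommGroup F]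
    [NormedSpace ℂ F] [CompleteSpace F] {f : ℂ → F} (hf : Differentiable ℂ f)
    (hβ : f =O[cobounded ℂ] fun z => ‖z‖ ^ β) {k : ℕ} (hk : β < k) :
    iteratedDeriv k f 0 = 0 := by
  obtain ⟨C, hC⟩ := hβ.bound
  obtain ⟨R, -, hR⟩ := hasBasis_cobounded_norm.eventually_iff.1 hC
  have hlim : Tendsto (fun r : ℝ => k.factorial * C * r ^ (-(k - β))) atTop (nhds 0) := by
    simpa only [mul_zero] using
      (tendsto_rpow_neg_atTop (sub_pos.2 hk)).const_mul (k.factorial * C)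
  refine norm_le_zero_iff.1 (ge_of_tendsto hlim ?_)
  filter_upwards [eventually_ge_atTop R, eventually_gt_atTop 0] with r hRr hr
  have hsphere : ∀ z ∈ sphere (0 : ℂ) r, ‖f z‖ ≤ C * r ^ β := fun z hz => by
    have hzr : ‖z‖ = r := mem_sphere_zero_iff_norm.1 hz
    simpa only [hzr, norm_of_nonneg (rpow_nonneg hr.le β)] using hR (hRr.trans_eq hzr.symm)
  calc ‖iteratedDeriv k f 0‖ ≤ k.factorial * (C * r ^ β) / r ^ k :=
        Complex.norm_iteratedDeriv_le_of_forall_mem_sphere_norm_le k hr hf.diffContOnCl hsphere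
    _ = k.factorial * C * r ^ (-(k - β)) := by
        rw [neg_sub, rpow_sub hr, rpow_natCast]
        ring

theorem exists_polynomial_of_isBigO_rpow (hf : Differentiable ℂ f)
    (hβ : f =O[cobounded ℂ] fun z => ‖z‖ ^ β) {N : ℕ} (hN : β < N) :
    ∃ p : Polynomial ℂ, (∀ z, f z = p.eval z) ∧ p.degree < N := by
  refine ⟨∑ k ∈ Finset.range N,
    Polynomial.monomial k ((k.factorial : ℂ)⁻¹ * iteratedDeriv k f 0), fun z => ?_, ?_⟩
  · rw [← Complex.taylorSeries_eq_of_entire' 0 z hf, tsum_eq_sum (s := Finset.range N)]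
    · simp [Polynomial.eval_finsetSum]
    · intro k hk
      have hNk : (N : ℝ) ≤ k := by exact_mod_cast not_lt.1 (mt Finset.mem_range.2 hk)
      rw [iteratedDeriv_zero_eq_zero_of_isBigO_rpow hf hβ (hN.trans_le hNk), mul_zero, zero_mul]
  · refine Polynomial.mem_degreeLT.1 (Submodule.sum_mem _ fun k hk => Polynomial.mem_degreeLT.2 ?_)
    exact (Polynomial.degree_monomial_le _ _).trans_lt
      (by exact_mod_cast Finset.mem_range.1 hk)

lemma exists_re_le_mul_one_add_rpow (hf : Continuous f) (hγ : 0 ≤ γ)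
    (hre : ∀ᶠ z in cobounded ℂ, (f z).re ≤ M * ‖z‖ ^ γ) :
    ∃ A > 0, ∀ r z, ‖z‖ ≤ r → (f z).re ≤ A * (1 + r ^ γ) := by
  obtain ⟨R, -, hR⟩ := hasBasis_cobounded_norm.eventually_iff.1 hre
  obtain ⟨B, hB⟩ := (isCompact_closedBall (0 : ℂ) R).bddAbove_image
    (Complex.continuous_re.comp hf).continuousOn
  refine ⟨|B| + |M| + 1, by positivity, fun r z hzr => ?_⟩
  have hr : 0 ≤ r := (norm_nonneg z).trans hzr
  have hzγ : ‖z‖ ^ γ ≤ r ^ γ := rpow_le_rpow (norm_nonneg z) hzr hγ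
  have hrγ : 0 ≤ r ^ γ := rpow_nonneg hr γ
  rcases le_total ‖z‖ R with hzR | hRz
  · have hfB : (f z).re ≤ B := hB ⟨z, mem_closedBall_zero_iff.2 hzR, rfl⟩
    calc (f z).re ≤ |B| + |M| + 1 := by linarith [le_abs_self B, abs_nonneg M]
      _ ≤ (|B| + |M| + 1) * (1 + r ^ γ) :=
          le_mul_of_one_le_right (by positivity) (by linarith)
  · calc (f z).re ≤ M * ‖z‖ ^ γ := hR hRz
      _ ≤ (|B| + |M| + 1) * (1 + r ^ γ) := by
          gcongr <;> linarith [le_abs_self M, abs_nonneg B]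

theorem isBigO_rpow_of_re_le (hf : Differentiable ℂ f) (hγ : 0 ≤ γ)
    (hre : ∀ᶠ z in cobounded ℂ, (f z).re ≤ M * ‖z‖ ^ γ) :
    f =O[cobounded ℂ] fun z => ‖z‖ ^ γ := by
  obtain ⟨A, hA, hfA⟩ := exists_re_le_mul_one_add_rpow hf.continuous hγ hre
  refine IsBigO.of_bound (2 * A * (1 + 2 ^ γ) + 3 * ‖f 0‖) ?_
  filter_upwards [tendsto_norm_cobounded_atTop.eventually_ge_atTop 1] with z hz
  have hz0 : 0 < ‖z‖ := by linarith
  have hzγ : 1 ≤ ‖z‖ ^ γ := one_le_rpow hz hγ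
  have hdouble : 2 * ‖z‖ - ‖z‖ = ‖z‖ := by ring
  calc ‖f z‖ ≤ 2 * (A * (1 + (2 * ‖z‖) ^ γ)) * ‖z‖ / (2 * ‖z‖ - ‖z‖)
          + ‖f 0‖ * (2 * ‖z‖ + ‖z‖) / (2 * ‖z‖ - ‖z‖) :=
        Complex.borelCaratheodory (by positivity) hf.differentiableOn
          (fun v hv => hfA _ v (mem_ball_zero_iff.1 hv).le) (by positivity)
          (by rw [mem_ball_zero_iff]; linarith)
    _ = 2 * A * (1 + 2 ^ γ * ‖z‖ ^ γ) + 3 * ‖f 0‖ := by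
        rw [mul_rpow two_pos.le hz0.le, hdouble]
        field_simp
        ring
    _ ≤ 2 * A * (‖z‖ ^ γ + 2 ^ γ * ‖z‖ ^ γ) + 3 * ‖f 0‖ * ‖z‖ ^ γ := by
        refine add_le_add (by gcongr) ?_
        exact le_mul_of_one_le_right (by positivity) hzγ
    _ = (2 * A * (1 + 2 ^ γ) + 3 * ‖f 0‖) * ‖‖z‖ ^ γ‖ := by
        rw [norm_of_nonneg (by positivity)]
        ring

/-- Borel–Carathéodory for a two-valued function: only `u ^ 2` has to be entire, and its real part
is controlled through `re (u ^ 2) ≤ (re u) ^ 2`. -/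
theorem isBigO_rpow_of_re_isBigO {u : ℂ → ℂ} (hu : Differentiable ℂ fun z => u z ^ 2)
    (hγ : 0 ≤ γ) (hre : (fun z => (u z).re) =O[cobounded ℂ] fun z => ‖z‖ ^ γ) :
    u =O[cobounded ℂ] fun z => ‖z‖ ^ γ := by
  obtain ⟨C, hC⟩ := hre.bound
  have hrpow_sq (z : ℂ) : ‖z‖ ^ (2 * γ) = (‖z‖ ^ γ) ^ 2 := by
    rw [mul_comm, rpow_mul (norm_nonneg z), rpow_two]
  have hre_sq : ∀ᶠ z in cobounded ℂ, (u z ^ 2).re ≤ C ^ 2 * ‖z‖ ^ (2 * γ) := by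
    filter_upwards [hC] with z hz
    calc (u z ^ 2).re = (u z).re ^ 2 - (u z).im ^ 2 := by
          rw [sq, Complex.mul_re]
          ring
      _ ≤ ‖(u z).re‖ ^ 2 := by
          rw [norm_eq_abs, sq_abs]
          exact sub_le_self _ (sq_nonneg _)
      _ ≤ (C * ‖‖z‖ ^ γ‖) ^ 2 := by gcongr
      _ = C ^ 2 * ‖z‖ ^ (2 * γ) := by rw [hrpow_sq, mul_pow, norm_eq_abs, sq_abs]
  refine IsBigO.of_pow two_ne_zero ?_
  exact (isBigO_rpow_of_re_le hu (by positivity) hre_sq).congr_right hrpow_sq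

end EntireFunctions

section Growth

variable {f : ℂ → ℂ} {b : ℝ}

lemma norm_le_maxModulus (hf : Continuous f) {z : ℂ} {r : ℝ} (hz : ‖z‖ ≤ r) :
    ‖f z‖ ≤ maxModulus f r :=
  le_csSup ((isCompact_closedBall 0 r).bddAbove_image hf.norm.continuousOn)
    ⟨z, mem_closedBall_zero_iff.2 hz, rfl⟩

lemma HasGrowthBound.posLog_norm_isBigO (h : HasGrowthBound f b) (hf : Continuous f) :
    (fun z => log⁺ ‖f z‖) =O[cobounded ℂ] fun z => ‖z‖ ^ b := by
  obtain ⟨C, hC⟩ := h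
  refine IsBigO.of_bound |C| ?_
  filter_upwards [tendsto_norm_cobounded_atTop.eventually hC] with z hz
  rw [norm_of_nonneg posLog_nonneg, norm_of_nonneg (by positivity)]
  rcases (norm_nonneg (f z)).eq_or_lt with hfz | hfz
  · rw [← hfz, posLog_zero]
    positivity
  · refine max_le (by positivity) ?_
    calc log ‖f z‖ ≤ log (maxModulus f ‖z‖) := log_le_log hfz (norm_le_maxModulus hf le_rfl)
      _ ≤ C * ‖z‖ ^ b := hz
      _ ≤ |C| * ‖z‖ ^ b := by
          gcongr
          exact le_abs_self C

theorem posLog_norm_isBigO_of_entireOrder_lt (hf : Continuous f) (h : entireOrder f < b) :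
    (fun z => log⁺ ‖f z‖) =O[cobounded ℂ] fun z => ‖z‖ ^ b := by
  obtain ⟨_, ⟨a, -, ha, rfl⟩, hab⟩ := sInf_lt_iff.1 h
  refine (ha.posLog_norm_isBigO hf).trans (IsBigO.of_norm_eventuallyLE ?_)
  filter_upwards [tendsto_norm_cobounded_atTop.eventually_ge_atTop 1] with z hz
  rw [norm_of_nonneg (by positivity)]
  exact rpow_le_rpow_of_exponent_le hz (EReal.coe_lt_coe_iff.1 hab).le

lemma isBigO_posLog_norm_rpow {α E F : Type*} [SeminormedAddCommGroup E]
    [SeminormedAddCommGroup F] {l : Filter α} {f : α → E} {g : α → F} (h : f =O[l] g)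
    (hb : 0 < b) : (fun a => log⁺ ‖f a‖) =O[l] fun a => ‖g a‖ ^ b := by
  have hposLog : (fun a => log⁺ ‖f a‖) =O[l] fun a => ‖f a‖ ^ b := by
    refine IsBigO.of_bound b⁻¹ (Eventually.of_forall fun a => ?_)
    rw [norm_of_nonneg posLog_nonneg, norm_of_nonneg (by positivity), inv_mul_eq_div]
    exact max_le (by positivity) (log_le_rpow_div (norm_nonneg _) hb)
  exact hposLog.trans (h.norm_norm.rpow hb.le (Eventually.of_forall fun _ => norm_nonneg _))

end Growth

section PellEquation

variable {ε : ℂ} {n : ℤ} {b : ℝ}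

lemma abs_log_norm_le_of_mul_eq_one {K : Type*} [NormedDivisionRing K] {a a' : K}
    (h : a * a' = 1) : |log ‖a‖| ≤ log⁺ ‖a - a'‖ + log 2 := by
  wlog ha : 1 ≤ ‖a‖ generalizing a a'
  · have hnorm : ‖a‖ * ‖a'‖ = 1 := by rw [← norm_mul, h, norm_one]
    have ha' : 1 ≤ ‖a'‖ := by nlinarith [norm_nonneg a, norm_nonneg a']
    rw [eq_inv_of_mul_eq_one_left hnorm, log_inv, abs_neg, norm_sub_rev]
    exact this (mul_eq_one_symm h) ha'
  have ha' : ‖a'‖ ≤ 1 := by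
    rw [eq_inv_of_mul_eq_one_right h, norm_inv]
    exact inv_le_one_of_one_le₀ ha
  calc |log ‖a‖| = log⁺ ‖a - a' + a'‖ := by
        rw [sub_add_cancel, abs_of_nonneg (log_nonneg ha), posLog_eq_log (by rwa [abs_norm])]
    _ ≤ log⁺ ‖a - a'‖ + log⁺ ‖a'‖ + log 2 := posLog_norm_add_le _ _
    _ = log⁺ ‖a - a'‖ + log 2 := by
        rw [(posLog_eq_zero_iff ‖a'‖).2 (by rwa [abs_norm]), add_zero]

theorem abs_re_le_of_pell {x y z w u : ℂ} (hw : w ^ 2 = z ^ 2 - 1)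
    (hpell : x ^ 2 - (z ^ 2 - 1) * y ^ 2 = 1) (hε : ‖ε‖ = 1)
    (hdef : x + y * w = ε * (z + w) ^ n * Complex.exp u) :
    |u.re| ≤ log⁺ ‖y‖ + (|(n : ℝ)| + 1) * (log⁺ ‖2 * w‖ + log 2) := by
  have hxyw : (x + y * w) * (x - y * w) = 1 := by linear_combination hpell - y ^ 2 * hw
  have hzw : (z + w) * (z - w) = 1 := by linear_combination -hw
  have hlog : log ‖x + y * w‖ = n * log ‖z + w‖ + u.re := by
    have hzpow : ‖(z + w) ^ n‖ ≠ 0 :=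
      norm_ne_zero_iff.2 (zpow_ne_zero n (left_ne_zero_of_mul_eq_one hzw))
    rw [hdef, norm_mul, norm_mul, hε, one_mul, Complex.norm_exp,
      log_mul hzpow (exp_pos _).ne', norm_zpow, log_zpow, log_exp]
  have hlog_xyw : |log ‖x + y * w‖| ≤ log⁺ ‖y‖ + log⁺ ‖2 * w‖ + log 2 := by
    have hsub : x + y * w - (x - y * w) = y * (2 * w) := by ring
    grw [abs_log_norm_le_of_mul_eq_one hxyw, hsub, norm_mul, posLog_mul]
  have hlog_zw : |log ‖z + w‖| ≤ log⁺ ‖2 * w‖ + log 2 := by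
    have hsub : z + w - (z - w) = 2 * w := by ring
    simpa only [hsub] using abs_log_norm_le_of_mul_eq_one hzw
  calc |u.re| = |log ‖x + y * w‖ - n * log ‖z + w‖| := by rw [hlog, add_sub_cancel_left]
    _ ≤ |log ‖x + y * w‖| + |(n : ℝ)| * |log ‖z + w‖| := by
        rw [← abs_mul]
        exact abs_sub _ _
    _ ≤ log⁺ ‖y‖ + log⁺ ‖2 * w‖ + log 2 + |(n : ℝ)| * (log⁺ ‖2 * w‖ + log 2) := by gcongr
    _ = log⁺ ‖y‖ + (|(n : ℝ)| + 1) * (log⁺ ‖2 * w‖ + log 2) := by ring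

lemma isTheta_id_of_sq_eq_sq_sub_const {K : Type*} [NormedField K] {w : K → K} {c : K}
    (hw : ∀ z, w z ^ 2 = z ^ 2 - c) : w =Θ[cobounded K] id := by
  have hsq : Tendsto (fun z : K => ‖z ^ 2‖) (cobounded K) atTop := by
    simpa only [norm_pow, Function.comp_def] using
      (tendsto_pow_atTop two_ne_zero).comp (tendsto_norm_cobounded_atTop (E := K))
  have hequiv : w ^ 2 ~[cobounded K] id ^ 2 := by
    have hw_sub : w ^ 2 - id ^ 2 = fun _ => -c := funext fun z => by simp [hw]
    rw [IsEquivalent, hw_sub]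
    exact isLittleO_const_left.2 (Or.inr hsq)
  exact ⟨hequiv.isBigO.of_pow two_ne_zero, hequiv.isBigO_symm.of_pow two_ne_zero⟩

theorem re_isBigO_of_pell {x y u w : ℂ → ℂ} (hw : ∀ z, w z ^ 2 = z ^ 2 - 1)
    (hpell : ∀ z, x z ^ 2 - (z ^ 2 - 1) * y z ^ 2 = 1) (hε : ‖ε‖ = 1)
    (hdef : ∀ z, x z + y z * w z = ε * (z + w z) ^ n * Complex.exp (u z)) (hb : 0 < b)
    (hy : (fun z => log⁺ ‖y z‖) =O[cobounded ℂ] fun z => ‖z‖ ^ b) :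
    (fun z => (u z).re) =O[cobounded ℂ] fun z => ‖z‖ ^ b := by
  have hw_log : (fun z => log⁺ ‖2 * w z‖) =O[cobounded ℂ] fun z => ‖z‖ ^ b :=
    isBigO_posLog_norm_rpow
      ((isTheta_id_of_sq_eq_sq_sub_const hw).isBigO.const_mul_left 2) hb
  have hconst : (fun _ => log 2) =O[cobounded ℂ] fun z => ‖z‖ ^ b :=
    (isLittleO_const_left.2 (Or.inr (tendsto_norm_atTop_atTop.comp
      ((tendsto_rpow_atTop hb).comp tendsto_norm_cobounded_atTop)))).isBigO
  refine IsBigO.trans (IsBigO.of_norm_le fun z => ?_)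
    (hy.add ((hw_log.add hconst).const_mul_left (|(n : ℝ)| + 1)))
  exact abs_re_le_of_pell (hw z) (hpell z) hε (hdef z)

lemma isBigO_rpow_sub_one_of_mul_isBigO {K : Type*} [NormedField K] {h w : K → K}
    (hw : id =O[cobounded K] w)
    (hhw : (fun z => h z * w z) =O[cobounded K] fun z => ‖z‖ ^ b) :
    h =O[cobounded K] fun z => ‖z‖ ^ (b - 1) := by
  have hmul : (fun z => h z * z) =O[cobounded K] fun z => ‖z‖ ^ b :=
    ((isBigO_refl h _).mul hw).trans hhw
  have hne : ∀ᶠ z in cobounded K, z ≠ 0 := eventually_ne_cobounded 0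
  refine (hmul.mul (isBigO_refl (fun z : K => z⁻¹) _).norm_right).congr' ?_ ?_
  · filter_upwards [hne] with z hz
    exact mul_inv_cancel_right₀ hz (h z)
  · filter_upwards [hne] with z hz
    rw [norm_inv, rpow_sub_one (norm_ne_zero_iff.2 hz), div_eq_mul_inv]

end PellEquation

/-- Here `w` is any choice, for each `z`, of a square root of `z² - 1`. -/
theorem theorem3p2 (x y h w : ℂ → ℂ) (ε : ℂ) (n : ℤ) (ρ : ℝ)
    (hw : ∀ z : ℂ, w z ^ 2 = z ^ 2 - 1)
    (hxy : IsEntirePellSolution x y)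
    (hε : ε = -1 ∨ ε = 1)
    (hh : Differentiable ℂ h)
    (hdef : ∀ z : ℂ, x z + y z * w z = ε * (z + w z) ^ n * Complex.exp (h z * w z))
    (hρ : 0 ≤ ρ)
    (hy : entireOrder y ≤ (ρ : EReal)) :
    ∃ p : Polynomial ℂ, (∀ z : ℂ, h z = p.eval z) ∧ intDegree p ≤ ⌊ρ⌋ - 1 := by
  obtain ⟨b, hρb, hbN⟩ := exists_between (Nat.lt_floor_add_one ρ)
  have hb : 0 < b := hρ.trans_lt hρb
  have hε_norm : ‖ε‖ = 1 := by rcases hε with rfl | rfl <;> simp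
  have hre : (fun z => (h z * w z).re) =O[cobounded ℂ] fun z => ‖z‖ ^ b :=
    re_isBigO_of_pell hw hxy.pell hε_norm hdef hb
      (posLog_norm_isBigO_of_entireOrder_lt hxy.entire_y.continuous
        (hy.trans_lt (EReal.coe_lt_coe_iff.2 hρb)))
  have hhw_sq : Differentiable ℂ fun z => (h z * w z) ^ 2 := by
    simp only [mul_pow, hw]
    fun_prop
  have hh_growth : h =O[cobounded ℂ] fun z => ‖z‖ ^ (b - 1) :=
    isBigO_rpow_sub_one_of_mul_isBigO (isTheta_id_of_sq_eq_sq_sub_const hw).isBigO_symm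
      (isBigO_rpow_of_re_isBigO hhw_sq hb.le hre)
  obtain ⟨p, hp, hdeg⟩ := exists_polynomial_of_isBigO_rpow hh hh_growth (sub_lt_iff_lt_add.2 hbN)
  refine ⟨p, hp, Int.le_sub_one_of_lt ?_⟩
  rw [← Int.natCast_floor_eq_floor hρ]
  exact intDegree_lt_natCast_iff.2 hdeg
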